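/- Let $G,c>0$ be constants, let $Q\in\mathbb R\setminus\{0\}$ and $M\in\mathbb R$, and let $\zeta$ be an admissible reduced Hamiltonian, i.e. a real function on $[0,\infty)$, twice differentiable on $(0,\infty)$, such that (R1) $\lim_{\mu\downarrow 0}\zeta(\mu)/\mu=1$; (R2) $\zeta'(\mu)>0$ and $\zeta(\mu)-\mu\zeta'(\mu)\ge 0$ for all $\mu>0$; (R3) $\zeta'(\mu)+2\mu\zeta''(\mu)\ge 0$ for all $\mu>0$; (R4) $\int_0^\infty y^{-7/4}\zeta(y)\,dy<\infty$; (R5) there are constants $J,K,L>0$ such that $J\sqrt\mu-K\le\zeta(\mu)\le J\sqrt\mu$ and $J\sqrt\mu-2L\le 2\mu\zeta'(\mu)\le J\sqrt\mu$ for all $\mu>0$. Let $$m(r)=M-\frac1{c^2}\int_r^\infty\zeta\Big(\frac{Q^2}{2s^4}\Big)s^2\,ds,\qquad \varphi(r)=Q\int_r^\infty\zeta'\Big(\frac{Q^2}{2s^4}\Big)\frac{1}{s^2}\,ds\qquad(r>0),$$ and suppose that $1-\frac{2Gm(r)}{c^2r}>0$ for all $r>0$ (there is no horizon). Let $(\mathcal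 M,\mathbf g,\mathbf F)$ be the corresponding electrostatic spherically symmetric spacetime of a point charge: $\mathcal M=\mathbb R\times(\mathbb R^3\setminus\{0\})$ with time coordinate $t$ and spherical coordinates $(r,\theta,\phi)$ on $\mathbb R^3\setminus\{0\}$, $$\mathbf g=-e^{2\alpha(r)}c^2dt^2+e^{-2\alpha(r)}dr^2+r^2(d\theta^2+\sin^2\theta\,d\phi^2),\qquad e^{2\alpha(r)}=1-\frac{2Gm(r)}{c^2r},$$ and $\mathbf F=d\mathbf A$ with $\mathbf A=\varphi(r)\,c\,dt$. Then the twice-contracted second Bianchi identity holds weakly everywhere on $\mathbb R^4=\mathbb R\times\mathbb R^3$, including at the central timelike singularity $\{r=0\}$: for every smooth compactly supported vector field $\psi$ on $\mathbb R^4$, the function $G^\mu{}_\nu\nabla_\mu\psi^\nu$, where $G^\mu{}_\nu=R^\mu{}_\nu-\frac12R\,\delta^\mu_\nu$ is the Einstein tensor of $\mathbf g$ and $\nabla$ its Levi-Civita connection, is integrable with respect to $d\mathrm{vol}_{\mathbf g}$, and $$\int_{\mathbb R^4}G^\mu{}_\nu\,\nabla_\mu\psi^\nu\,d\mathrm{vol}_{\mathbf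 g}=0 .$$ -/

import Mathlib

noncomputable section

/-! ### Tensor calculus in one global coordinate chart `x = (x⁰, x¹, x², x³)` of `ℝ⁴` -/

/-- A (0,2)-tensor field on (part of) `ℝ⁴`, given by its components. -/
abbrev TensorField2 : Type := (Fin 4 → ℝ) → Matrix (Fin 4) (Fin 4) ℝ

/-- The partial derivative `∂f / ∂x^μ` at `x`. -/
def partialDeriv (μ : Fin 4) (f : (Fin 4 → ℝ) → ℝ) (x : Fin 4 → ℝ) : ℝ :=
  fderiv ℝ f x (Pi.single μ 1)

/-- The Christoffel symbol `Γ^l_{μν}` of the Levi-Civita connection of `g`. -/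
def christoffel (g : TensorField2) (l μ ν : Fin 4) (x : Fin 4 → ℝ) : ℝ :=
  (1 / 2) * ∑ σ, (g x)⁻¹ l σ *
    (partialDeriv μ (fun y => g y σ ν) x + partialDeriv ν (fun y => g y σ μ) x
      - partialDeriv σ (fun y => g y μ ν) x)

/-- The Riemann curvature tensor `R^ρ_{σμν}` of `g`. -/
def riemann (g : TensorField2) (ρ σ μ ν : Fin 4) (x : Fin 4 → ℝ) : ℝ :=
  partialDeriv μ (christoffel g ρ ν σ) x - partialDeriv ν (christoffel g ρ μ σ) x
    + ∑ l, (christoffel g ρ μ l x * christoffel g l ν σ x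
        - christoffel g ρ ν l x * christoffel g l μ σ x)

/-- The Ricci tensor `R_{μν} = R^ρ_{μρν}` of `g`. -/
def ricci (g : TensorField2) (μ ν : Fin 4) (x : Fin 4 → ℝ) : ℝ :=
  ∑ ρ, riemann g ρ μ ρ ν x

/-- The scalar curvature `R = g^{μν} R_{μν}` of `g`. -/
def scalarCurvature (g : TensorField2) (x : Fin 4 → ℝ) : ℝ :=
  ∑ μ, ∑ ν, (g x)⁻¹ μ ν * ricci g μ ν x

/-- The mixed Einstein tensor `G^μ_ν = R^μ_ν - (1/2) R δ^μ_ν` of `g`. -/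
def einsteinMixed (g : TensorField2) (μ ν : Fin 4) (x : Fin 4 → ℝ) : ℝ :=
  ∑ σ, (g x)⁻¹ μ σ * ricci g σ ν x - (1 / 2) * scalarCurvature g x * (if μ = ν then 1 else 0)

/-- The covariant derivative `∇_μ ψ^ν = ∂_μ ψ^ν + Γ^ν_{μl} ψ^l` of a vector field `ψ`. -/
def covDeriv (g : TensorField2) (ψ : (Fin 4 → ℝ) → (Fin 4 → ℝ)) (μ ν : Fin 4)
    (x : Fin 4 → ℝ) : ℝ :=
  partialDeriv μ (fun y => ψ y ν) x + ∑ l, christoffel g ν μ l x * ψ x l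

/-- The density `√|det g|` of the volume element of `g` with respect to Lebesgue measure. -/
def volDensity (g : TensorField2) (x : Fin 4 → ℝ) : ℝ :=
  Real.sqrt |(g x).det|

/-- The integrand `G^μ_ν ∇_μ ψ^ν √|det g|` of the weak form of the Bianchi identity. -/
def bianchiIntegrand (g : TensorField2) (ψ : (Fin 4 → ℝ) → (Fin 4 → ℝ)) (x : Fin 4 → ℝ) : ℝ :=
  (∑ μ, ∑ ν, einsteinMixed g μ ν x * covDeriv g ψ μ ν x) * volDensity g x

/-- The twice-contracted second Bianchi identity holds weakly on all of `ℝ⁴`: for every smooth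
compactly supported vector field `ψ` on `ℝ⁴` the integral `∫ G^μ_ν ∇_μ ψ^ν dvol_g` exists
(as a Lebesgue integral) and vanishes. The metric may be undefined on a null set. -/
def WeakBianchi (g : TensorField2) : Prop :=
  ∀ ψ : (Fin 4 → ℝ) → (Fin 4 → ℝ),
    ContDiff ℝ ((⊤ : ℕ∞) : WithTop ℕ∞) ψ → HasCompactSupport ψ →
      MeasureTheory.Integrable (bianchiIntegrand g ψ) ∧ ∫ x, bianchiIntegrand g ψ x = 0

/-! ### Static spherically symmetric metrics and fields

The coordinates are `t = x 0` and the Cartesian coordinates `(x 1, x 2, x 3)`. -/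

/-- The area radius `r = √(x₁² + x₂² + x₃²)`; the world line of the center is `r = 0`. -/
def areaRadius (x : Fin 4 → ℝ) : ℝ :=
  Real.sqrt (x 1 ^ 2 + x 2 ^ 2 + x 3 ^ 2)

/-- The components of the 1-form `dt`. -/
def dtForm (μ : Fin 4) : ℝ := if μ = 0 then 1 else 0

/-- The components `∂_μ r` of the 1-form `dr` off the world line `r = 0`. -/
def drForm (x : Fin 4 → ℝ) (μ : Fin 4) : ℝ := if μ = 0 then 0 else x μ / areaRadius x

/-- The components of the spatial Euclidean metric `dx₁² + dx₂² + dx₃²`, which in spherical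
coordinates is `dr² + r² (dθ² + sin² θ dφ²)`. -/
def spatialEuclidean (μ ν : Fin 4) : ℝ := if μ = ν ∧ μ ≠ 0 then 1 else 0

/-- The metric `-e^{2α} c² dt² + e^{2β} dr² + r² (dθ² + sin² θ dφ²)`, where
`r² (dθ² + sin² θ dφ²) = dx₁² + dx₂² + dx₃² - dr²`. -/
def staticSphericalMetric (c : ℝ) (α β : ℝ → ℝ) : TensorField2 := fun x =>
  Matrix.of fun μ ν =>
    -(Real.exp (2 * α (areaRadius x)) * c ^ 2 * (dtForm μ * dtForm ν))
      + Real.exp (2 * β (areaRadius x)) * (drForm x μ * drForm x ν)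
      + (spatialEuclidean μ ν - drForm x μ * drForm x ν)

/-- The components `F_{μν} = ∂_μ A_ν - ∂_ν A_μ` of the exterior derivative of the 1-form `A`. -/
def exteriorDeriv (A : (Fin 4 → ℝ) → Fin 4 → ℝ) : TensorField2 := fun x =>
  Matrix.of fun μ ν =>
    partialDeriv μ (fun y => A y ν) x - partialDeriv ν (fun y => A y μ) x

/-! ### Electrostatic spacetimes of a point charge -/

/-- Admissible reduced Hamiltonians `ζ`, twice differentiable on `(0, ∞)`. Only the values of `ζ`
on `(0, ∞)` matter. In `R4` the integrand is nonnegative by `R2`, so that integrability means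
that the integral is finite. -/
structure AdmissibleHamiltonian (ζ : ℝ → ℝ) : Prop where
  diff : ∀ μ : ℝ, 0 < μ → DifferentiableAt ℝ ζ μ
  diff_deriv : ∀ μ : ℝ, 0 < μ → DifferentiableAt ℝ (deriv ζ) μ
  R1 : Filter.Tendsto (fun μ => ζ μ / μ) (nhdsWithin 0 (Set.Ioi 0)) (nhds 1)
  R2 : ∀ μ : ℝ, 0 < μ → 0 < deriv ζ μ ∧ 0 ≤ ζ μ - μ * deriv ζ μ
  R3 : ∀ μ : ℝ, 0 < μ → 0 ≤ deriv ζ μ + 2 * μ * deriv (deriv ζ) μ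
  R4 : MeasureTheory.IntegrableOn (fun y : ℝ => y ^ (-(7 / 4) : ℝ) * ζ y) (Set.Ioi 0)
  R5 : ∃ J K L : ℝ, 0 < J ∧ 0 < K ∧ 0 < L ∧ ∀ μ : ℝ, 0 < μ →
    (J * Real.sqrt μ - K ≤ ζ μ ∧ ζ μ ≤ J * Real.sqrt μ) ∧
    (J * Real.sqrt μ - 2 * L ≤ 2 * deriv ζ μ * μ ∧ 2 * deriv ζ μ * μ ≤ J * Real.sqrt μ)

/-- The cumulative mass function `m(r) = M - c⁻² ∫_r^∞ ζ(Q² / (2 s⁴)) s² ds`. -/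
def massFunction (c Q M : ℝ) (ζ : ℝ → ℝ) (r : ℝ) : ℝ :=
  M - (1 / c ^ 2) * ∫ s in Set.Ioi r, ζ (Q ^ 2 / (2 * s ^ 4)) * s ^ 2

/-- The electrostatic potential `φ(r) = Q ∫_r^∞ ζ'(Q² / (2 s⁴)) s⁻² ds`. -/
def electricPotential (Q : ℝ) (ζ : ℝ → ℝ) (r : ℝ) : ℝ :=
  Q * ∫ s in Set.Ioi r, deriv ζ (Q ^ 2 / (2 * s ^ 4)) * (1 / s ^ 2)

/-- `(ℝ × (ℝ³ \ {0}), g, F)` is the electrostatic spherically symmetric spacetime of a point charge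
`Q` with ADM mass `M` for the reduced Hamiltonian `ζ`:
`g = -e^{2α} c² dt² + e^{-2α} dr² + r² (dθ² + sin² θ dφ²)` with `e^{2α} = 1 - 2 G m(r) / (c² r)`
for all `r > 0`, and `F = dA` with `A = φ(r) c dt`. That `1 - 2 G m(r) / (c² r)` is positive for all
`r > 0`, as it must be to equal an exponential, means that there is no horizon. -/
structure IsElectrostaticSpacetime (GN c Q M : ℝ) (ζ : ℝ → ℝ) (g F : TensorField2) : Prop where
  metric : ∃ α : ℝ → ℝ,
    (∀ r : ℝ, 0 < r → Real.exp (2 * α r) = 1 - 2 * GN * massFunction c Q M ζ r / (c ^ 2 * r)) ∧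
    ∀ x : Fin 4 → ℝ, 0 < areaRadius x → g x = staticSphericalMetric c α (fun r => -α r) x
  field : ∀ x : Fin 4 → ℝ, 0 < areaRadius x →
    F x = exteriorDeriv (fun y ν => electricPotential Q ζ (areaRadius y) * c * dtForm ν) x

end

noncomputable section

/-! ### Partial derivatives -/

/-! Put s = r² and let φ(s) be the lapse e^{2α}. Since g_tt and g_rr have reciprocal factors φ and
1/φ, the Cartesian determinant of g is the constant -c². The mixed Einstein tensor has one
eigenvalue p on the t-r plane and b = p + s p' on the tangential directions. Because p is shared and
the determinant is constant, all Christoffel terms drop out of G^μ_ν ∇_μ ψ^ν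
(`bianchiIntegrand_radialMetric`). What remains is a flat statement: T = p dt² + (p + s p') δ - p'
X⊗X is weakly divergence free on ℝ⁴.

If p is C¹ up to s = 0, then T : ∂ψ is a sum of divergences and Jacobian determinants of compactly
supported functions, so it integrates to zero (`hasZeroIntegral_stressContraction_of_regular`). This
uses p' but never p''.

For the point charge, p = -(2G/c⁴) ζ(Q²/(2s²)). The Schwarzschild-type part of φ, however singular,
does not contribute to G. The upper bounds in `R5` give |p| ≤ C/s and |p'| ≤ C/s², so T = O(1/r²) is
locally integrable on space. Replacing p(s) by p(s + ε) makes the field regular under the same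
bound, and dominated convergence as ε → 0 leaves no contribution from the center
(`hasZeroIntegral_stressContraction`). -/

/-- The squared area radius `x₁² + x₂² + x₃²`. -/
def radiusSq (x : Fin 4 → ℝ) : ℝ := x 1 ^ 2 + x 2 ^ 2 + x 3 ^ 2

/-- The components of the spatial position vector `(0, x₁, x₂, x₃)`. -/
def spatialPart (x : Fin 4 → ℝ) (μ : Fin 4) : ℝ := if μ = 0 then 0 else x μ

/-- `f` is differentiable at `x` with the partial derivatives `D μ`. -/
def HasPartialDerivs (f : (Fin 4 → ℝ) → ℝ) (D : Fin 4 → ℝ) (x : Fin 4 → ℝ) : Prop :=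
  DifferentiableAt ℝ f x ∧ ∀ μ, partialDeriv μ f x = D μ

namespace HasPartialDerivs

variable {f h : (Fin 4 → ℝ) → ℝ} {D E : Fin 4 → ℝ} {x : Fin 4 → ℝ}

theorem of_hasFDerivAt {L : (Fin 4 → ℝ) →L[ℝ] ℝ} (hf : HasFDerivAt f L x)
    (hL : ∀ μ, L (Pi.single μ 1) = D μ) : HasPartialDerivs f D x :=
  ⟨hf.differentiableAt, fun μ => by rw [partialDeriv, hf.fderiv, hL]⟩

theorem congr_derivs (hf : HasPartialDerivs f D x) (hE : ∀ μ, D μ = E μ) :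
    HasPartialDerivs f E x :=
  ⟨hf.1, fun μ => (hf.2 μ).trans (hE μ)⟩

theorem const (a : ℝ) (x : Fin 4 → ℝ) : HasPartialDerivs (fun _ => a) (fun _ => 0) x :=
  of_hasFDerivAt (hasFDerivAt_const a x) fun _ => rfl

theorem add (hf : HasPartialDerivs f D x) (hh : HasPartialDerivs h E x) :
    HasPartialDerivs (fun y => f y + h y) (fun μ => D μ + E μ) x :=
  of_hasFDerivAt (hf.1.hasFDerivAt.fun_add hh.1.hasFDerivAt) fun μ => by
    simpa [partialDeriv] using congrArg₂ (· + ·) (hf.2 μ) (hh.2 μ)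

theorem mul (hf : HasPartialDerivs f D x) (hh : HasPartialDerivs h E x) :
    HasPartialDerivs (fun y => f y * h y) (fun μ => D μ * h x + f x * E μ) x :=
  of_hasFDerivAt (hf.1.hasFDerivAt.fun_mul hh.1.hasFDerivAt) fun μ => by
    have h1 := hf.2 μ
    have h2 := hh.2 μ
    simp only [partialDeriv] at h1 h2
    simp [h1, h2]
    ring

theorem const_mul (a : ℝ) (hf : HasPartialDerivs f D x) :
    HasPartialDerivs (fun y => a * f y) (fun μ => a * D μ) x :=
  ((const a x).mul hf).congr_derivs fun μ => by ring

theorem mul_const (a : ℝ) (hf : HasPartialDerivs f D x) :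
    HasPartialDerivs (fun y => f y * a) (fun μ => D μ * a) x :=
  (hf.mul (const a x)).congr_derivs fun μ => by ring

theorem coord (i : Fin 4) (x : Fin 4 → ℝ) :
    HasPartialDerivs (fun y => y i) (fun μ => if μ = i then 1 else 0) x :=
  of_hasFDerivAt (hasFDerivAt_apply i x) fun μ => by
    simp [Pi.single_apply, eq_comm]

theorem spatialPart (i : Fin 4) (x : Fin 4 → ℝ) :
    HasPartialDerivs (fun y => spatialPart y i) (fun μ => spatialEuclidean μ i) x := by
  by_cases hi : i = 0
  · refine HasPartialDerivs.congr_derivs (D := fun _ => 0) ?_ fun μ => ?_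
    · simpa [_root_.spatialPart, hi] using const 0 x
    · simp only [spatialEuclidean, hi]
      split_ifs with h'
      · exact absurd h'.1 h'.2
      · rfl
  · refine HasPartialDerivs.congr_derivs (D := fun μ => if μ = i then 1 else 0) ?_ fun μ => ?_
    · simpa [_root_.spatialPart, hi] using coord i x
    · by_cases h : μ = i <;> simp [spatialEuclidean, h, hi]

theorem congr_of_eventuallyEq (hf : HasPartialDerivs f D x) (hh : h =ᶠ[nhds x] f) :
    HasPartialDerivs h D x :=
  of_hasFDerivAt (hf.1.hasFDerivAt.congr_of_eventuallyEq hh) hf.2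

theorem comp_hasDerivAt {F : ℝ → ℝ} {F' : ℝ} (hF : HasDerivAt F F' (f x))
    (hf : HasPartialDerivs f D x) : HasPartialDerivs (fun y => F (f y)) (fun μ => F' * D μ) x :=
  of_hasFDerivAt (hF.comp_hasFDerivAt x hf.1.hasFDerivAt) fun μ => by
    simpa [partialDeriv] using Or.inl (hf.2 μ)

end HasPartialDerivs

theorem hasPartialDerivs_radiusSq (x : Fin 4 → ℝ) :
    HasPartialDerivs radiusSq (fun μ => 2 * spatialPart x μ) x := by
  have h := fun i => (HasPartialDerivs.coord i x).mul (HasPartialDerivs.coord i x)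
  have h' := ((h 1).add (h 2)).add (h 3)
  have e : radiusSq = fun y => y 1 * y 1 + y 2 * y 2 + y 3 * y 3 := by
    funext y; simp only [radiusSq]; ring
  rw [e]
  refine h'.congr_derivs fun μ => ?_
  fin_cases μ <;> simp [spatialPart] <;> ring

theorem continuous_radiusSq : Continuous radiusSq := by
  unfold radiusSq; fun_prop

theorem HasPartialDerivs.radial {F : ℝ → ℝ} {F' : ℝ} {x : Fin 4 → ℝ}
    (hF : HasDerivAt F F' (radiusSq x)) :
    HasPartialDerivs (fun y => F (radiusSq y)) (fun μ => 2 * F' * _root_.spatialPart x μ) x :=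
  (HasPartialDerivs.comp_hasDerivAt hF (hasPartialDerivs_radiusSq x)).congr_derivs
    fun μ => by ring

/-! ### Curvature of a static spherically symmetric metric -/

/-- The metric `-c² φ dt² + dx₁² + dx₂² + dx₃² + (1/φ - 1) dr²`, where `φ` is a function of the
squared area radius. -/
def radialMetric (c : ℝ) (φ : ℝ → ℝ) : TensorField2 := fun x => Matrix.of fun μ ν =>
  -(c ^ 2 * φ (radiusSq x)) * (dtForm μ * dtForm ν) + spatialEuclidean μ ν
    + ((φ (radiusSq x))⁻¹ - 1) / radiusSq x * (spatialPart x μ * spatialPart x ν)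

/-- The inverse of `radialMetric`. -/
def radialMetricInv (c : ℝ) (φ : ℝ → ℝ) : TensorField2 := fun x => Matrix.of fun μ ν =>
  -(c ^ 2 * φ (radiusSq x))⁻¹ * (dtForm μ * dtForm ν) + spatialEuclidean μ ν
    + (φ (radiusSq x) - 1) / radiusSq x * (spatialPart x μ * spatialPart x ν)

theorem spatialEuclidean_comm (μ ν : Fin 4) : spatialEuclidean μ ν = spatialEuclidean ν μ := by
  fin_cases μ <;> fin_cases ν <;> simp [spatialEuclidean]

/-- X is an eigenvector of the spatial block, with eigenvalue g^{rr} = φ. With its `dtForm` analogue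
this raises indices without expanding into components. -/
theorem radialMetricInv_sum_spatialPart (c : ℝ) (φ : ℝ → ℝ) {x : Fin 4 → ℝ}
    (hx : radiusSq x ≠ 0) (l : Fin 4) :
    ∑ σ, radialMetricInv c φ x l σ * spatialPart x σ = φ (radiusSq x) * spatialPart x l := by
  have h0 : (φ (radiusSq x) - 1) / radiusSq x * radiusSq x = φ (radiusSq x) - 1 :=
    div_mul_cancel₀ _ hx
  nth_rewrite 3 [radiusSq] at h0
  generalize hv : (φ (radiusSq x) - 1) / radiusSq x = v at h0
  fin_cases l <;>
    simp [radialMetricInv, Fin.sum_univ_four, spatialPart, dtForm, spatialEuclidean, hv]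
  · linear_combination x 1 * h0
  · linear_combination x 2 * h0
  · linear_combination x 3 * h0

theorem radialMetricInv_sum_dtForm (c : ℝ) (φ : ℝ → ℝ) (x : Fin 4 → ℝ) (l : Fin 4) :
    ∑ σ, radialMetricInv c φ x l σ * dtForm σ = -(c ^ 2 * φ (radiusSq x))⁻¹ * dtForm l := by
  fin_cases l <;>
    simp [radialMetricInv, spatialPart, dtForm, spatialEuclidean]

theorem radialMetric_mul_radialMetricInv {c : ℝ} (hc : c ≠ 0) {φ : ℝ → ℝ} {x : Fin 4 → ℝ}
    (hx : radiusSq x ≠ 0) (hφ : φ (radiusSq x) ≠ 0) :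
    radialMetric c φ x * radialMetricInv c φ x = 1 := by
  have h0 : (φ (radiusSq x) - 1) / radiusSq x * radiusSq x = φ (radiusSq x) - 1 :=
    div_mul_cancel₀ _ hx
  have h1 : ((φ (radiusSq x))⁻¹ - 1) / radiusSq x
      = -(φ (radiusSq x))⁻¹ * ((φ (radiusSq x) - 1) / radiusSq x) := by field_simp; ring
  have h2 : (φ (radiusSq x))⁻¹ * φ (radiusSq x) = 1 := inv_mul_cancel₀ hφ
  have h3 : (c ^ 2 * φ (radiusSq x))⁻¹ * (c ^ 2 * φ (radiusSq x)) = 1 :=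
    inv_mul_cancel₀ (mul_ne_zero (pow_ne_zero 2 hc) hφ)
  nth_rewrite 3 [radiusSq] at h0
  generalize hv : (φ (radiusSq x) - 1) / radiusSq x = v at h0 h1
  generalize hw : (c ^ 2 * φ (radiusSq x))⁻¹ = w at h3
  generalize hi : (φ (radiusSq x))⁻¹ = i at h1 h2
  generalize hp : φ (radiusSq x) = p at *
  have key : ∀ a b : ℝ, a * b * (v - i * v - i * v * (p - 1)) = 0 := by
    intro a b; linear_combination (-a * b * v) * h2
  ext μ ν
  fin_cases μ <;> fin_cases ν <;>
    simp [Matrix.mul_apply, radialMetric, radialMetricInv, Fin.sum_univ_four, spatialPart, dtForm,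
      spatialEuclidean, h1, hv, hw, hp, hi, -mul_inv_rev]
  all_goals first
    | linear_combination h3
    | linear_combination key (x 1) (x 1) - i * v * x 1 * x 1 * h0
    | linear_combination key (x 2) (x 2) - i * v * x 2 * x 2 * h0
    | linear_combination key (x 3) (x 3) - i * v * x 3 * x 3 * h0
    | linear_combination key (x 1) (x 2) - i * v * x 1 * x 2 * h0
    | linear_combination key (x 1) (x 3) - i * v * x 1 * x 3 * h0
    | linear_combination key (x 2) (x 3) - i * v * x 2 * x 3 * h0

theorem radialMetric_inv {c : ℝ} (hc : c ≠ 0) {φ : ℝ → ℝ} {x : Fin 4 → ℝ}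
    (hx : radiusSq x ≠ 0) (hφ : φ (radiusSq x) ≠ 0) :
    (radialMetric c φ x)⁻¹ = radialMetricInv c φ x :=
  Matrix.inv_eq_right_inv (radialMetric_mul_radialMetricInv hc hx hφ)

/-- The factors φ and 1/φ of the t and r directions cancel. Hence the volume density is constant and
Γ^ρ_{ρμ} vanishes. -/
theorem radialMetric_det (c : ℝ) {φ : ℝ → ℝ} {x : Fin 4 → ℝ}
    (hx : radiusSq x ≠ 0) (hφ : φ (radiusSq x) ≠ 0) :
    (radialMetric c φ x).det = -c ^ 2 := by
  have h0 : ((φ (radiusSq x))⁻¹ - 1) / radiusSq x * radiusSq x = (φ (radiusSq x))⁻¹ - 1 :=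
    div_mul_cancel₀ _ hx
  have h2 : (φ (radiusSq x))⁻¹ * φ (radiusSq x) = 1 := inv_mul_cancel₀ hφ
  nth_rewrite 3 [radiusSq] at h0
  generalize hv : ((φ (radiusSq x))⁻¹ - 1) / radiusSq x = v at h0
  simp [Matrix.det_succ_row_zero, Fin.sum_univ_succ, radialMetric, spatialPart, dtForm,
    spatialEuclidean, hv, Fin.succAbove]
  linear_combination (c ^ 2 * φ (radiusSq x)) * h0 + c ^ 2 * h2

/-- `φ` is positive on `(0, ∞)` with first and second derivatives `φ₁`, `φ₂` there. -/
structure IsRadialProfile (φ φ₁ φ₂ : ℝ → ℝ) : Prop where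
  pos : ∀ s, 0 < s → 0 < φ s
  hasDerivAt : ∀ s, 0 < s → HasDerivAt φ (φ₁ s) s
  hasDerivAt_deriv : ∀ s, 0 < s → HasDerivAt φ₁ (φ₂ s) s

theorem eventually_radiusSq_pos {x : Fin 4 → ℝ} (hx : 0 < radiusSq x) :
    ∀ᶠ y in nhds x, 0 < radiusSq y :=
  continuous_radiusSq.continuousAt.eventually (lt_mem_nhds hx)

/-- `Γ^l_{μν} = X^l (P T_μ T_ν + A δ_{μν} + B X_μ X_ν) + E T^l (T_μ X_ν + T_ν X_μ)`, where `T` and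
`X` are the time and the spatial position covectors. -/
def radialConnection (A B P E : ℝ) (x : Fin 4 → ℝ) (l μ ν : Fin 4) : ℝ :=
  spatialPart x l * (P * (dtForm μ * dtForm ν) + A * spatialEuclidean μ ν
      + B * (spatialPart x μ * spatialPart x ν))
    + E * (dtForm l * (dtForm μ * spatialPart x ν + dtForm ν * spatialPart x μ))

section

variable {c : ℝ} {φ φ₁ φ₂ : ℝ → ℝ} {g : TensorField2} {x : Fin 4 → ℝ}

theorem christoffel_eq_radialConnection (hc : c ≠ 0) (hφ : IsRadialProfile φ φ₁ φ₂)
    (hg : ∀ y, 0 < radiusSq y → g y = radialMetric c φ y) (hx : 0 < radiusSq x)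
    (l μ ν : Fin 4) :
    christoffel g l μ ν x = radialConnection ((1 - φ (radiusSq x)) / radiusSq x)
      (-(φ₁ (radiusSq x) / φ (radiusSq x) + (1 - φ (radiusSq x)) / radiusSq x) / radiusSq x)
      (c ^ 2 * (φ (radiusSq x) * φ₁ (radiusSq x))) (φ₁ (radiusSq x) / φ (radiusSq x)) x l μ ν := by
  have hs := hx.ne'
  have hp := (hφ.pos _ hx).ne'
  have hU : HasDerivAt (fun s => ((φ s)⁻¹ - 1) / s)
      ((-φ₁ (radiusSq x) / φ (radiusSq x) ^ 2 * radiusSq x - ((φ (radiusSq x))⁻¹ - 1) * 1)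
        / radiusSq x ^ 2) (radiusSq x) :=
    (((hφ.hasDerivAt _ hx).fun_inv hp).sub_const 1).fun_div (hasDerivAt_id' _) hs
  have hd : ∀ μ ν : Fin 4, HasPartialDerivs (fun y => g y μ ν) (fun σ =>
      -(c ^ 2 * (2 * φ₁ (radiusSq x) * spatialPart x σ)) * (dtForm μ * dtForm ν)
      + (2 * ((-φ₁ (radiusSq x) / φ (radiusSq x) ^ 2 * radiusSq x
          - ((φ (radiusSq x))⁻¹ - 1) * 1) / radiusSq x ^ 2) * spatialPart x σ
            * (spatialPart x μ * spatialPart x ν)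
        + ((φ (radiusSq x))⁻¹ - 1) / radiusSq x * (spatialEuclidean σ μ * spatialPart x ν
            + spatialPart x μ * spatialEuclidean σ ν))) x := by
    intro μ ν
    have h1 := ((((HasPartialDerivs.radial (hφ.hasDerivAt _ hx)).const_mul (-c ^ 2)).mul_const
      (dtForm μ * dtForm ν)).add (HasPartialDerivs.const (spatialEuclidean μ ν) x)).add
      ((HasPartialDerivs.radial hU).mul
        ((HasPartialDerivs.spatialPart μ x).mul (HasPartialDerivs.spatialPart ν x)))
    refine (h1.congr_of_eventuallyEq ?_).congr_derivs fun σ => ?_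
    · filter_upwards [eventually_radiusSq_pos hx] with y hy
      rw [hg y hy]
      simp [radialMetric]
    · ring
  have hX := radialMetricInv_sum_spatialPart c φ hs l
  have hT := radialMetricInv_sum_dtForm c φ x l
  simp only [christoffel, hg x hx, radialMetric_inv hc hs hp, (hd _ _).2]
  rw [Fin.sum_univ_four] at hX hT ⊢
  simp only [radialConnection, spatialEuclidean_comm 0 μ, spatialEuclidean_comm 1 μ,
    spatialEuclidean_comm 2 μ, spatialEuclidean_comm 3 μ, spatialEuclidean_comm 0 ν,
    spatialEuclidean_comm 1 ν, spatialEuclidean_comm 2 ν, spatialEuclidean_comm 3 ν,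
    spatialEuclidean_comm ν μ]
  have e1 : φ (radiusSq x) * (((-φ₁ (radiusSq x) / φ (radiusSq x) ^ 2 * radiusSq x
          - ((φ (radiusSq x))⁻¹ - 1) * 1) / radiusSq x ^ 2))
      = -(φ₁ (radiusSq x) / φ (radiusSq x) + (1 - φ (radiusSq x)) / radiusSq x) / radiusSq x := by
    field_simp; ring
  have e2 : φ (radiusSq x) * (((φ (radiusSq x))⁻¹ - 1) / radiusSq x)
      = (1 - φ (radiusSq x)) / radiusSq x := by field_simp
  have e3 : c ^ 2 * φ₁ (radiusSq x) * (c ^ 2 * φ (radiusSq x))⁻¹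
      = φ₁ (radiusSq x) / φ (radiusSq x) := by field_simp
  rw [← e1, ← e2, ← e3]
  generalize ((-φ₁ (radiusSq x) / φ (radiusSq x) ^ 2 * radiusSq x
          - ((φ (radiusSq x))⁻¹ - 1) * 1) / radiusSq x ^ 2) = U1
  generalize ((φ (radiusSq x))⁻¹ - 1) / radiusSq x = U
  -- In the Christoffel symbols of the first kind the terms with δ_{σμ} and δ_{σν} cancel, so the
  -- index σ to be raised occurs only through T_σ and X_σ.
  linear_combination (-c ^ 2 * φ₁ (radiusSq x) *
      (spatialPart x μ * dtForm ν + spatialPart x ν * dtForm μ)) * hT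
    + (c ^ 2 * φ₁ (radiusSq x) * dtForm μ * dtForm ν
      + U1 * spatialPart x μ * spatialPart x ν + U * spatialEuclidean μ ν) * hX

theorem hasPartialDerivs_radialConnection {A B P E : ℝ → ℝ} {A' B' P' E' : ℝ}
    (hA : HasDerivAt A A' (radiusSq x)) (hB : HasDerivAt B B' (radiusSq x))
    (hP : HasDerivAt P P' (radiusSq x)) (hE : HasDerivAt E E' (radiusSq x)) (l μ ν : Fin 4) :
    HasPartialDerivs (fun y => radialConnection (A (radiusSq y)) (B (radiusSq y)) (P (radiusSq y))
        (E (radiusSq y)) y l μ ν) (fun ρ =>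
      spatialEuclidean ρ l * (P (radiusSq x) * (dtForm μ * dtForm ν)
          + A (radiusSq x) * spatialEuclidean μ ν
          + B (radiusSq x) * (spatialPart x μ * spatialPart x ν))
        + spatialPart x l * (2 * spatialPart x ρ * (P' * (dtForm μ * dtForm ν)
            + A' * spatialEuclidean μ ν + B' * (spatialPart x μ * spatialPart x ν))
          + B (radiusSq x) * (spatialEuclidean ρ μ * spatialPart x ν
            + spatialPart x μ * spatialEuclidean ρ ν))
        + 2 * E' * spatialPart x ρ
            * (dtForm l * (dtForm μ * spatialPart x ν + dtForm ν * spatialPart x μ))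
        + E (radiusSq x) * (dtForm l * (dtForm μ * spatialEuclidean ρ ν
            + dtForm ν * spatialEuclidean ρ μ))) x := by
  have hs := fun i => HasPartialDerivs.spatialPart i x
  have h := ((hs l).mul
    ((((HasPartialDerivs.radial hP).mul_const (dtForm μ * dtForm ν)).add
      ((HasPartialDerivs.radial hA).mul_const (spatialEuclidean μ ν))).add
      ((HasPartialDerivs.radial hB).mul ((hs μ).mul (hs ν))))).add
    ((HasPartialDerivs.radial hE).mul
      ((((hs ν).const_mul (dtForm μ)).add ((hs μ).const_mul (dtForm ν))).const_mul (dtForm l)))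
  exact h.congr_derivs fun ρ => by ring

/-- The Ricci tensor of a connection of the form `radialConnection` with vanishing trace
`Γ^ρ_{ρμ} = (A + s B + E) X_μ`, where `s` is the squared area radius. -/
theorem ricci_of_radialConnection {A B P E : ℝ → ℝ} {A' B' P' E' : ℝ}
    (hx : 0 < radiusSq x)
    (hΓ : ∀ y, 0 < radiusSq y → ∀ l μ ν, christoffel g l μ ν y =
      radialConnection (A (radiusSq y)) (B (radiusSq y)) (P (radiusSq y)) (E (radiusSq y)) y l μ ν)
    (hA : HasDerivAt A A' (radiusSq x)) (hB : HasDerivAt B B' (radiusSq x))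
    (hP : HasDerivAt P P' (radiusSq x)) (hE : HasDerivAt E E' (radiusSq x))
    (h0 : A (radiusSq x) + radiusSq x * B (radiusSq x) + E (radiusSq x) = 0)
    (h1 : A' + B (radiusSq x) + radiusSq x * B' + E' = 0) (μ ν : Fin 4) :
    ricci g μ ν x =
      (3 * P (radiusSq x) + 2 * radiusSq x * P' - 2 * radiusSq x * E (radiusSq x) * P (radiusSq x))
          * (dtForm μ * dtForm ν)
        + (3 * A (radiusSq x) + 2 * radiusSq x * A') * spatialEuclidean μ ν
        + (5 * B (radiusSq x) + 2 * radiusSq x * B' - 2 * E (radiusSq x) ^ 2)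
          * (spatialPart x μ * spatialPart x ν) := by
  have hd : ∀ ρ l μ ν, partialDeriv ρ (christoffel g l μ ν) x = _ := fun ρ l μ ν =>
    ((hasPartialDerivs_radialConnection hA hB hP hE l μ ν).congr_of_eventuallyEq (by
      filter_upwards [eventually_radiusSq_pos hx] with y hy
      exact hΓ y hy l μ ν)).2 ρ
  simp only [ricci, riemann, hd, hΓ x hx]
  generalize A (radiusSq x) = a at *
  generalize B (radiusSq x) = b at *
  generalize P (radiusSq x) = p at *
  -- The vanishing trace and its derivative eliminate E and E', which leaves a polynomial identity
  -- in the coordinates.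
  have he : E (radiusSq x) = -a - radiusSq x * b := by linear_combination h0
  have he' : E' = -A' - b - radiusSq x * B' := by linear_combination h1
  rw [he, he']
  simp only [radialConnection, radiusSq, Fin.sum_univ_four]
  fin_cases μ <;> fin_cases ν <;> simp [dtForm, spatialPart, spatialEuclidean] <;> ring

end

/-! ### The Einstein tensor and the reduction to a flat divergence -/

section

variable {c : ℝ} {φ φ₁ φ₂ : ℝ → ℝ} {g : TensorField2} {x : Fin 4 → ℝ}

theorem ricci_radialMetric (hc : c ≠ 0) (hφ : IsRadialProfile φ φ₁ φ₂)
    (hg : ∀ y, 0 < radiusSq y → g y = radialMetric c φ y) (hx : 0 < radiusSq x) {p b : ℝ}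
    (hp : p = 2 * φ₁ (radiusSq x) + (φ (radiusSq x) - 1) / radiusSq x)
    (hb : b = 3 * φ₁ (radiusSq x) + 2 * radiusSq x * φ₂ (radiusSq x)) (μ ν : Fin 4) :
    ricci g μ ν x = c ^ 2 * φ (radiusSq x) * b * (dtForm μ * dtForm ν)
      - p * spatialEuclidean μ ν
      + (p - b / φ (radiusSq x)) / radiusSq x * (spatialPart x μ * spatialPart x ν) := by
  have hs := hx.ne'
  have hpos := (hφ.pos _ hx).ne'
  have h1 := hφ.hasDerivAt _ hx
  have h2 := hφ.hasDerivAt_deriv _ hx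
  have hA := (h1.const_sub 1).fun_div (hasDerivAt_id' _) hs
  have hE := h2.fun_div h1 hpos
  have hB := (hE.fun_add hA).fun_neg.fun_div (hasDerivAt_id' _) hs
  have hP := (h1.fun_mul h2).const_mul (c ^ 2)
  rw [ricci_of_radialConnection hx
    (fun y hy l μ ν => christoffel_eq_radialConnection hc hφ hg hy l μ ν) hA hB hP hE
    (by field_simp; ring) (by field_simp; ring) μ ν, hp, hb]
  congr 1
  · congr 1
    · congr 1
      field_simp; ring
    · rw [← neg_mul]
      congr 1
      field_simp; ring
  · congr 1
    field_simp; ring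

theorem radialMetricInv_sum_spatialEuclidean (c : ℝ) (φ : ℝ → ℝ) (x : Fin 4 → ℝ) (l ν : Fin 4) :
    ∑ σ, radialMetricInv c φ x l σ * spatialEuclidean σ ν = spatialEuclidean l ν
      + (φ (radiusSq x) - 1) / radiusSq x * (spatialPart x l * spatialPart x ν) := by
  fin_cases l <;> fin_cases ν <;>
    simp [radialMetricInv, Fin.sum_univ_four, spatialPart, dtForm, spatialEuclidean]

theorem mixedRicci_radialMetric (hc : c ≠ 0) (hφ : IsRadialProfile φ φ₁ φ₂)
    (hg : ∀ y, 0 < radiusSq y → g y = radialMetric c φ y) (hx : 0 < radiusSq x) {p b : ℝ}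
    (hp : p = 2 * φ₁ (radiusSq x) + (φ (radiusSq x) - 1) / radiusSq x)
    (hb : b = 3 * φ₁ (radiusSq x) + 2 * radiusSq x * φ₂ (radiusSq x)) (μ ν : Fin 4) :
    ∑ σ, (g x)⁻¹ μ σ * ricci g σ ν x = -b * (dtForm μ * dtForm ν) - p * spatialEuclidean μ ν
      + (p - b) / radiusSq x * (spatialPart x μ * spatialPart x ν) := by
  have hs := hx.ne'
  have hpos := (hφ.pos _ hx).ne'
  simp only [hg x hx, radialMetric_inv hc hs hpos, ricci_radialMetric hc hφ hg hx hp hb]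
  have hX := radialMetricInv_sum_spatialPart c φ hs μ
  have hT := radialMetricInv_sum_dtForm c φ x μ
  have hS := radialMetricInv_sum_spatialEuclidean c φ x μ ν
  have e1 : c ^ 2 * φ (radiusSq x) * (c ^ 2 * φ (radiusSq x))⁻¹ = 1 :=
    mul_inv_cancel₀ (mul_ne_zero (pow_ne_zero 2 hc) hpos)
  have e2 : (p - b / φ (radiusSq x)) / radiusSq x * φ (radiusSq x)
      - p * ((φ (radiusSq x) - 1) / radiusSq x) = (p - b) / radiusSq x := by
    field_simp; ring
  rw [Fin.sum_univ_four] at hX hT hS ⊢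
  linear_combination (c ^ 2 * φ (radiusSq x) * b * dtForm ν) * hT - p * hS
    + (p - b / φ (radiusSq x)) / radiusSq x * spatialPart x ν * hX
    - b * dtForm μ * dtForm ν * e1 + spatialPart x μ * spatialPart x ν * e2

theorem ricci_radialMetric_comm (hc : c ≠ 0) (hφ : IsRadialProfile φ φ₁ φ₂)
    (hg : ∀ y, 0 < radiusSq y → g y = radialMetric c φ y) (hx : 0 < radiusSq x) (μ ν : Fin 4) :
    ricci g μ ν x = ricci g ν μ x := by
  rw [ricci_radialMetric hc hφ hg hx rfl rfl, ricci_radialMetric hc hφ hg hx rfl rfl,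
    spatialEuclidean_comm, mul_comm (dtForm μ), mul_comm (spatialPart x μ)]

theorem scalarCurvature_radialMetric (hc : c ≠ 0) (hφ : IsRadialProfile φ φ₁ φ₂)
    (hg : ∀ y, 0 < radiusSq y → g y = radialMetric c φ y) (hx : 0 < radiusSq x) {p b : ℝ}
    (hp : p = 2 * φ₁ (radiusSq x) + (φ (radiusSq x) - 1) / radiusSq x)
    (hb : b = 3 * φ₁ (radiusSq x) + 2 * radiusSq x * φ₂ (radiusSq x)) :
    scalarCurvature g x = -2 * (p + b) := by
  -- Symmetry of the Ricci tensor turns g^{μν} R_{μν} into the trace of the mixed Ricci tensor,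
  -- which is already computed.
  have h : scalarCurvature g x = ∑ μ, ∑ ν, (g x)⁻¹ μ ν * ricci g ν μ x := by
    simp only [scalarCurvature, ricci_radialMetric_comm hc hφ hg hx]
  have e : (p - b) / radiusSq x * (x 1 ^ 2 + x 2 ^ 2 + x 3 ^ 2) = p - b :=
    div_mul_cancel₀ _ hx.ne'
  simp only [h, mixedRicci_radialMetric hc hφ hg hx hp hb, Fin.sum_univ_four]
  simp [dtForm, spatialPart, spatialEuclidean]
  linear_combination e

theorem einsteinMixed_radialMetric (hc : c ≠ 0) (hφ : IsRadialProfile φ φ₁ φ₂)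
    (hg : ∀ y, 0 < radiusSq y → g y = radialMetric c φ y) (hx : 0 < radiusSq x) {p b : ℝ}
    (hp : p = 2 * φ₁ (radiusSq x) + (φ (radiusSq x) - 1) / radiusSq x)
    (hb : b = 3 * φ₁ (radiusSq x) + 2 * radiusSq x * φ₂ (radiusSq x)) (μ ν : Fin 4) :
    einsteinMixed g μ ν x = p * (dtForm μ * dtForm ν) + b * spatialEuclidean μ ν
      + (p - b) / radiusSq x * (spatialPart x μ * spatialPart x ν) := by
  have h : (if μ = ν then (1 : ℝ) else 0) = dtForm μ * dtForm ν + spatialEuclidean μ ν := by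
    fin_cases μ <;> fin_cases ν <;> simp [dtForm, spatialEuclidean]
  rw [einsteinMixed, mixedRicci_radialMetric hc hφ hg hx hp hb,
    scalarCurvature_radialMetric hc hφ hg hx hp hb, h]
  ring

/-- The contraction `T^μ_ν ∂_μ ψ^ν` with `T^μ_ν = p T^μ T_ν + b δ^μ_ν + q X^μ X_ν`, where `δ` is the
spatial Euclidean metric. -/
def stressContraction (p b q : ℝ) (ψ : (Fin 4 → ℝ) → Fin 4 → ℝ) (x : Fin 4 → ℝ) : ℝ :=
  ∑ μ, ∑ ν, (p * (dtForm μ * dtForm ν) + b * spatialEuclidean μ ν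
    + q * (spatialPart x μ * spatialPart x ν)) * partialDeriv μ (fun y => ψ y ν) x

/-- The Christoffel terms amount to half of G^{μν} ∂_λ g_{μν}. The t and r contributions carry the
same eigenvalue p and opposite logarithmic derivatives ±φ'/φ; rotating the radial direction only
gives entries mixing radial and tangential directions, on which G vanishes. -/
theorem bianchiIntegrand_radialMetric (hc : c ≠ 0) (hφ : IsRadialProfile φ φ₁ φ₂)
    (hg : ∀ y, 0 < radiusSq y → g y = radialMetric c φ y) (hx : 0 < radiusSq x) {p b : ℝ}
    (hp : p = 2 * φ₁ (radiusSq x) + (φ (radiusSq x) - 1) / radiusSq x)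
    (hb : b = 3 * φ₁ (radiusSq x) + 2 * radiusSq x * φ₂ (radiusSq x))
    (ψ : (Fin 4 → ℝ) → Fin 4 → ℝ) :
    bianchiIntegrand g ψ x = stressContraction p b ((p - b) / radiusSq x) ψ x * |c| := by
  have hs := hx.ne'
  have hpos := (hφ.pos _ hx).ne'
  have hvol : volDensity g x = |c| := by
    rw [volDensity, hg x hx, radialMetric_det c hs hpos, abs_neg, abs_pow,
      Real.sqrt_sq (abs_nonneg c)]
  have e1 : (p - b) / radiusSq x * (x 1 ^ 2 + x 2 ^ 2 + x 3 ^ 2) = p - b :=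
    div_mul_cancel₀ _ hs
  rw [bianchiIntegrand, hvol, stressContraction]
  congr 1
  simp only [covDeriv, einsteinMixed_radialMetric hc hφ hg hx hp hb,
    christoffel_eq_radialConnection hc hφ hg hx]
  have e2 : (1 - φ (radiusSq x)) / radiusSq x
      + (x 1 ^ 2 + x 2 ^ 2 + x 3 ^ 2) * (-(φ₁ (radiusSq x) / φ (radiusSq x)
        + (1 - φ (radiusSq x)) / radiusSq x) / radiusSq x)
      + φ₁ (radiusSq x) / φ (radiusSq x) = 0 := by
    change _ + radiusSq x * _ + _ = _
    field_simp; ring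
  generalize (1 - φ (radiusSq x)) / radiusSq x = A at e2 ⊢
  generalize -(φ₁ (radiusSq x) / φ (radiusSq x) + A) / radiusSq x = B at e2 ⊢
  generalize φ₁ (radiusSq x) / φ (radiusSq x) = E at e2 ⊢
  generalize (p - b) / radiusSq x = q at e1 ⊢
  have hE : E = -A - (x 1 ^ 2 + x 2 ^ 2 + x 3 ^ 2) * B := by linear_combination e2
  have hp' : p = b + q * (x 1 ^ 2 + x 2 ^ 2 + x 3 ^ 2) := by linear_combination -e1
  subst hE
  rw [hp']
  simp only [radialConnection, Fin.sum_univ_four]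
  simp [dtForm, spatialPart, spatialEuclidean]
  ring

end

/-! ### Integration by parts -/

/-- `f` is integrable with vanishing integral. -/
def HasZeroIntegral (f : (Fin 4 → ℝ) → ℝ) : Prop :=
  MeasureTheory.Integrable f ∧ ∫ x, f x = 0

namespace HasZeroIntegral

theorem add {f h : (Fin 4 → ℝ) → ℝ} (hf : HasZeroIntegral f) (hh : HasZeroIntegral h) :
    HasZeroIntegral fun x => f x + h x :=
  ⟨hf.1.add hh.1, by rw [MeasureTheory.integral_add hf.1 hh.1, hf.2, hh.2, add_zero]⟩

theorem const_mul {f : (Fin 4 → ℝ) → ℝ} (a : ℝ) (hf : HasZeroIntegral f) :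
    HasZeroIntegral fun x => a * f x :=
  ⟨hf.1.const_mul a, by rw [MeasureTheory.integral_const_mul, hf.2, mul_zero]⟩

theorem sum {ι : Type*} {s : Finset ι} {f : ι → (Fin 4 → ℝ) → ℝ}
    (hf : ∀ i ∈ s, HasZeroIntegral (f i)) : HasZeroIntegral fun x => ∑ i ∈ s, f i x :=
  ⟨MeasureTheory.integrable_finsetSum s fun i hi => (hf i hi).1, by
    rw [MeasureTheory.integral_finsetSum s fun i hi => (hf i hi).1]
    exact Finset.sum_eq_zero fun i hi => (hf i hi).2⟩

end HasZeroIntegral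

section

variable {Φ h : (Fin 4 → ℝ) → ℝ}

theorem continuous_partialDeriv (hΦ : ContDiff ℝ 1 Φ) (k : Fin 4) :
    Continuous (partialDeriv k Φ) :=
  (hΦ.continuous_fderiv one_ne_zero).clm_apply continuous_const

theorem HasCompactSupport.partialDeriv (hs : HasCompactSupport h) (k : Fin 4) :
    HasCompactSupport (partialDeriv k h) :=
  hs.fderiv_apply ℝ _

theorem contDiff_partialDeriv (hh : ContDiff ℝ 2 h) (k : Fin 4) :
    ContDiff ℝ 1 (partialDeriv k h) :=
  (hh.fderiv_right (m := 1) (by norm_num)).clm_apply contDiff_const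

theorem partialDeriv_comm (hh : ContDiff ℝ 2 h) (j k : Fin 4) (x : Fin 4 → ℝ) :
    partialDeriv k (partialDeriv j h) x = partialDeriv j (partialDeriv k h) x := by
  have hd : DifferentiableAt ℝ (fderiv ℝ h) x :=
    ((hh.fderiv_right (m := 1) (by norm_num)).differentiable one_ne_zero) x
  have h2 : ∀ i l : Fin 4, partialDeriv l (partialDeriv i h) x
      = fderiv ℝ (fderiv ℝ h) x (Pi.single l 1) (Pi.single i 1) := by
    intro i l
    change fderiv ℝ (fun y => fderiv ℝ h y (Pi.single i 1)) x _ = _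
    rw [fderiv_clm_apply hd (differentiableAt_const _)]
    simp
  rw [h2, h2]
  exact (hh.contDiffAt.isSymmSndFDerivAt (by simp)).eq _ _

theorem integrable_mul_of_hasCompactSupport (hΦ : Continuous Φ) (hh : Continuous h)
    (hs : HasCompactSupport h) : MeasureTheory.Integrable fun x => Φ x * h x :=
  (hΦ.mul hh).integrable_of_hasCompactSupport hs.mul_left

theorem integral_mul_partialDeriv (hΦ : ContDiff ℝ 1 Φ) (hh : ContDiff ℝ 1 h)
    (hs : HasCompactSupport h) (k : Fin 4) :
    ∫ x, Φ x * partialDeriv k h x = -∫ x, partialDeriv k Φ x * h x :=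
  integral_mul_fderiv_eq_neg_fderiv_mul_of_integrable
    (integrable_mul_of_hasCompactSupport (continuous_partialDeriv hΦ k) hh.continuous hs)
    (integrable_mul_of_hasCompactSupport hΦ.continuous (continuous_partialDeriv hh k)
      (hs.partialDeriv k))
    (integrable_mul_of_hasCompactSupport hΦ.continuous hh.continuous hs)
    (fun x _ => hΦ.differentiable one_ne_zero x) (fun x _ => hh.differentiable one_ne_zero x)

theorem hasZeroIntegral_partialDeriv_mul (hΦ : ContDiff ℝ 1 Φ) (hh : ContDiff ℝ 1 h)
    (hs : HasCompactSupport h) (k : Fin 4) :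
    HasZeroIntegral fun x => Φ x * partialDeriv k h x + partialDeriv k Φ x * h x := by
  have h1 := integrable_mul_of_hasCompactSupport hΦ.continuous (continuous_partialDeriv hh k)
      (hs.partialDeriv k)
  have h2 := integrable_mul_of_hasCompactSupport (continuous_partialDeriv hΦ k) hh.continuous hs
  refine ⟨h1.add h2, ?_⟩
  rw [MeasureTheory.integral_add h1 h2, integral_mul_partialDeriv hΦ hh hs, neg_add_cancel]

/-- The Jacobian determinants `∂_kΦ ∂_jh - ∂_jΦ ∂_kh` are null Lagrangians. -/
theorem hasZeroIntegral_jacobian (hΦ : ContDiff ℝ 1 Φ) (hh : ContDiff ℝ 2 h)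
    (hs : HasCompactSupport h) (j k : Fin 4) :
    HasZeroIntegral fun x => partialDeriv k Φ x * partialDeriv j h x
      - partialDeriv j Φ x * partialDeriv k h x := by
  -- The Jacobian is ∂_k(Φ ∂_j h) - ∂_j(Φ ∂_k h), where the second derivatives of h cancel; so Φ
  -- need only be C¹.
  have h1 := hasZeroIntegral_partialDeriv_mul hΦ (contDiff_partialDeriv hh j) (hs.partialDeriv j) k
  have h2 := hasZeroIntegral_partialDeriv_mul hΦ (contDiff_partialDeriv hh k) (hs.partialDeriv k) j
  convert h1.add (h2.const_mul (-1)) using 2 with x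
  rw [partialDeriv_comm hh j k]
  ring

end

/-! ### Regular radial stress tensors as null Lagrangians -/

theorem contDiff_radial {F F' : ℝ → ℝ} (hF : ∀ s, 0 ≤ s → HasDerivAt F (F' s) s)
    (hF' : ContinuousOn F' (Set.Ici 0)) : ContDiff ℝ 1 fun x => F (radiusSq x) := by
  have hs : ContDiff ℝ 1 radiusSq := by unfold radiusSq; fun_prop
  have h0 : ∀ x, 0 ≤ radiusSq x := fun x => by unfold radiusSq; positivity
  have hd : ∀ x, HasFDerivAt (fun x => F (radiusSq x)) (F' (radiusSq x) • fderiv ℝ radiusSq x) x :=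
    fun x => (hF _ (h0 x)).comp_hasFDerivAt x (hs.differentiable one_ne_zero x).hasFDerivAt
  rw [contDiff_one_iff_fderiv]
  refine ⟨fun x => (hd x).differentiableAt, ?_⟩
  rw [show fderiv ℝ (fun x => F (radiusSq x)) = fun x => F' (radiusSq x) • fderiv ℝ radiusSq x from
    funext fun x => (hd x).fderiv]
  exact (hF'.comp_continuous continuous_radiusSq h0).smul (hs.continuous_fderiv one_ne_zero)

/-- With Φ = F(s), the divergence of Φψ gives F div ψ + 2F' x·ψ. Half the sum over spatial k, j of
the Jacobians of Φ and x_k ψ^j gives F'(s div ψ - x_j x_k ∂_k ψ^j - 2 x·ψ), with the spatial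
divergence. The undifferentiated terms cancel. -/
theorem hasZeroIntegral_stressContraction_of_regular {F F' : ℝ → ℝ}
    (hF : ∀ s, 0 ≤ s → HasDerivAt F (F' s) s) (hF' : ContinuousOn F' (Set.Ici 0))
    {ψ : (Fin 4 → ℝ) → Fin 4 → ℝ} (hψ : ∀ ν, ContDiff ℝ 2 fun x => ψ x ν)
    (hs : ∀ ν, HasCompactSupport fun x => ψ x ν) :
    HasZeroIntegral fun x => stressContraction (F (radiusSq x))
      (F (radiusSq x) + radiusSq x * F' (radiusSq x)) (-F' (radiusSq x)) ψ x := by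
  have hΦ := contDiff_radial hF hF'
  have h0 : ∀ x, 0 ≤ radiusSq x := fun x => by unfold radiusSq; positivity
  have hdΦ := fun x => HasPartialDerivs.radial (x := x) (hF _ (h0 x))
  have hc : ∀ k ν : Fin 4, ContDiff ℝ 2 fun x : Fin 4 → ℝ => x k * ψ x ν :=
    fun k ν => (contDiff_apply ℝ ℝ k).mul (hψ ν)
  have hdc : ∀ k ν μ x, partialDeriv μ (fun x => x k * ψ x ν) x
      = (if μ = k then 1 else 0) * ψ x ν + x k * partialDeriv μ (fun x => ψ x ν) x :=
    fun k ν μ x => ((HasPartialDerivs.coord k x).mul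
      (D := fun μ => if μ = k then 1 else 0) (E := fun μ => partialDeriv μ (fun x => ψ x ν) x)
      ⟨(hψ ν).differentiable two_ne_zero x, fun _ => rfl⟩).2 μ
  have h1 : HasZeroIntegral fun x => ∑ ν, (F (radiusSq x) * partialDeriv ν (fun y => ψ y ν) x
      + partialDeriv ν (fun x => F (radiusSq x)) x * ψ x ν) :=
    HasZeroIntegral.sum fun ν _ =>
      hasZeroIntegral_partialDeriv_mul hΦ ((hψ ν).of_le one_le_two) (hs ν) ν
  have h2 : HasZeroIntegral fun x => ∑ k : Fin 3, ∑ j : Fin 3,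
      (partialDeriv k.succ (fun x => F (radiusSq x)) x
          * partialDeriv j.succ (fun x => x k.succ * ψ x j.succ) x
        - partialDeriv j.succ (fun x => F (radiusSq x)) x
          * partialDeriv k.succ (fun x => x k.succ * ψ x j.succ) x) :=
    HasZeroIntegral.sum fun k _ => HasZeroIntegral.sum fun j _ =>
      hasZeroIntegral_jacobian hΦ (hc _ _) (hs _).mul_left _ _
  convert h1.add (h2.const_mul (1 / 2)) using 2 with x
  simp only [hdc, (hdΦ x).2, stressContraction, Fin.sum_univ_four, Fin.sum_univ_three]
  generalize F (radiusSq x) = a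
  generalize F' (radiusSq x) = a'
  simp [dtForm, spatialPart, spatialEuclidean, radiusSq, Fin.reduceSucc]
  ring

/-! ### Local integrability of the inverse squared radius -/

theorem integrable_indicator_norm_rpow {a : ℝ} (ha : -1 < a) (R : ℝ) :
    MeasureTheory.Integrable fun t : ℝ => (Set.Iic R).indicator (fun y => y ^ a) ‖t‖ := by
  rw [MeasureTheory.integrable_fun_norm_addHaar MeasureTheory.volume]
  simp only [Module.finrank_self, tsub_self, pow_zero, one_smul]
  rw [MeasureTheory.IntegrableOn, MeasureTheory.integrable_indicator_iff measurableSet_Iic,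
    MeasureTheory.IntegrableOn, MeasureTheory.Measure.restrict_restrict measurableSet_Iic,
    Set.Iic_inter_Ioi]
  exact (intervalIntegral.intervalIntegrable_rpow' ha).1

theorem ae_ne_zero : ∀ᵐ x : Fin 4 → ℝ, ∀ i, x i ≠ 0 := by
  rw [MeasureTheory.ae_all_iff]
  intro i
  rw [MeasureTheory.ae_iff, MeasureTheory.volume_pi]
  simpa only [not_not] using MeasureTheory.Measure.pi_hyperplane (α := fun _ : Fin 4 => ℝ)
    (fun _ => MeasureTheory.volume) i 0

theorem radiusSq_pos_of_ne_zero {x : Fin 4 → ℝ} (hx : ∀ i, x i ≠ 0) : 0 < radiusSq x := by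
  have := pow_pos (abs_pos.2 (hx 1)) 2
  rw [sq_abs] at this
  unfold radiusSq; positivity

/-- Split 1/s into three factors s^(-1/3) and use s ≥ x_i² in each. The exponent -2/3 exceeds -1, so
the product is locally integrable by Fubini, without polar coordinates. -/
theorem inv_radiusSq_le_prod {x : Fin 4 → ℝ} (hx : ∀ i, x i ≠ 0) :
    (radiusSq x)⁻¹ ≤ ‖x 1‖ ^ (-(2 / 3) : ℝ) * ‖x 2‖ ^ (-(2 / 3) : ℝ) * ‖x 3‖ ^ (-(2 / 3) : ℝ) := by
  have hs := radiusSq_pos_of_ne_zero hx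
  have hle : ∀ t : ℝ, t ≠ 0 → t ^ 2 ≤ radiusSq x →
      radiusSq x ^ (-(1 / 3) : ℝ) ≤ ‖t‖ ^ (-(2 / 3) : ℝ) := by
    intro t ht h
    have h2 : ‖t‖ ^ (-(2 / 3) : ℝ) = (t ^ 2) ^ (-(1 / 3) : ℝ) := by
      rw [← sq_abs, ← Real.norm_eq_abs, ← Real.rpow_natCast, ← Real.rpow_mul (norm_nonneg t)]
      norm_num
    rw [h2]
    exact Real.rpow_le_rpow_of_nonpos (by positivity) h (by norm_num)
  have e : (radiusSq x)⁻¹ = radiusSq x ^ (-(1 / 3) : ℝ) * radiusSq x ^ (-(1 / 3) : ℝ)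
      * radiusSq x ^ (-(1 / 3) : ℝ) := by
    rw [← Real.rpow_add hs, ← Real.rpow_add hs, ← Real.rpow_neg_one]
    norm_num
  rw [e]
  gcongr
  · exact hle _ (hx 1) (by unfold radiusSq; nlinarith [sq_nonneg (x 2), sq_nonneg (x 3)])
  · exact hle _ (hx 2) (by unfold radiusSq; nlinarith [sq_nonneg (x 1), sq_nonneg (x 3)])
  · exact hle _ (hx 3) (by unfold radiusSq; nlinarith [sq_nonneg (x 1), sq_nonneg (x 2)])

theorem integrable_inv_radiusSq_mul {h : (Fin 4 → ℝ) → ℝ} (hh : Continuous h)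
    (hs : HasCompactSupport h) : MeasureTheory.Integrable fun x => (radiusSq x)⁻¹ * h x := by
  obtain ⟨K, hK⟩ := hs.exists_bound_of_continuous hh
  obtain ⟨R, hR⟩ := hs.isCompact.isBounded.subset_closedBall 0
  -- Exponent 0 for time: there the factor is just a cutoff.
  let a : Fin 4 → ℝ := fun i => if i = 0 then 0 else -(2 / 3)
  have ha : ∀ i, -1 < a i := fun i => by
    simp only [a]; split_ifs <;> norm_num
  have hprod : MeasureTheory.Integrable fun x : Fin 4 → ℝ =>
      ∏ i, (Set.Iic R).indicator (fun y => y ^ a i) ‖x i‖ :=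
    MeasureTheory.Integrable.fintype_prod (fun i => integrable_indicator_norm_rpow (ha i) R)
  refine (hprod.mul_const K).mono' ?_ ?_
  · exact (continuous_radiusSq.measurable.inv.mul hh.measurable).aestronglyMeasurable
  · filter_upwards [ae_ne_zero] with x hx
    by_cases hxh : h x = 0
    · have hK0 : 0 ≤ K := (norm_nonneg _).trans (hK x)
      simp only [hxh, mul_zero, norm_zero]
      refine mul_nonneg (Finset.prod_nonneg fun i _ => ?_) hK0
      exact Set.indicator_apply_nonneg fun _ => Real.rpow_nonneg (norm_nonneg _) _
    · have hxR : ∀ i, ‖x i‖ ∈ Set.Iic R := fun i => by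
        have := hR (subset_tsupport h hxh)
        rw [mem_closedBall_zero_iff] at this
        exact (norm_le_pi_norm x i).trans this
      simp only [Set.indicator_of_mem (hxR _), norm_mul, norm_inv]
      rw [Real.norm_of_nonneg (radiusSq_pos_of_ne_zero hx).le]
      refine mul_le_mul ?_ (hK x) (norm_nonneg _) (by positivity)
      simpa [Fin.prod_univ_four, a] using inv_radiusSq_le_prod hx

/-! ### Singular stress tensors -/

theorem abs_spatialPart_mul_le (x : Fin 4 → ℝ) (μ ν : Fin 4) :
    |spatialPart x μ * spatialPart x ν| ≤ radiusSq x := by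
  have h : ∀ μ, spatialPart x μ ^ 2 ≤ radiusSq x := fun μ => by
    fin_cases μ <;> simp [spatialPart, radiusSq] <;>
      nlinarith [sq_nonneg (x 1), sq_nonneg (x 2), sq_nonneg (x 3)]
  rw [abs_le]
  constructor <;> nlinarith [h μ, h ν, sq_nonneg (spatialPart x μ - spatialPart x ν),
    sq_nonneg (spatialPart x μ + spatialPart x ν)]

theorem abs_stressContraction_le {p b q C : ℝ} {x : Fin 4 → ℝ} (hp : |p| ≤ C) (hb : |b| ≤ 2 * C)
    (hq : |q| * radiusSq x ≤ C) (ψ : (Fin 4 → ℝ) → Fin 4 → ℝ) :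
    |stressContraction p b q ψ x|
      ≤ 4 * C * ∑ μ, ∑ ν, |partialDeriv μ (fun y => ψ y ν) x| := by
  rw [stressContraction, Finset.mul_sum]
  refine (Finset.abs_sum_le_sum_abs _ _).trans (Finset.sum_le_sum fun μ _ => ?_)
  rw [Finset.mul_sum]
  refine (Finset.abs_sum_le_sum_abs _ _).trans (Finset.sum_le_sum fun ν _ => ?_)
  rw [abs_mul]
  refine mul_le_mul_of_nonneg_right ?_ (abs_nonneg _)
  have h1 : |p * (dtForm μ * dtForm ν)| ≤ C := by
    rw [abs_mul]
    have : |dtForm μ * dtForm ν| ≤ 1 := by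
      simp only [dtForm]; split_ifs <;> simp
    nlinarith [abs_nonneg p]
  have h2 : |b * spatialEuclidean μ ν| ≤ 2 * C := by
    rw [abs_mul]
    have : |spatialEuclidean μ ν| ≤ 1 := by
      simp only [spatialEuclidean]; split_ifs <;> simp
    nlinarith [abs_nonneg b]
  have h3 : |q * (spatialPart x μ * spatialPart x ν)| ≤ C := by
    rw [abs_mul]
    exact (mul_le_mul_of_nonneg_left (abs_spatialPart_mul_le x μ ν) (abs_nonneg q)).trans hq
  calc _ ≤ _ := (abs_add_le _ _).trans (add_le_add_left (abs_add_le _ _) _)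
    _ ≤ 4 * C := by linarith

theorem hasZeroIntegral_stressContraction {p p' : ℝ → ℝ} {C : ℝ}
    (hp : ∀ s, 0 < s → HasDerivAt p (p' s) s) (hp' : ContinuousOn p' (Set.Ioi 0))
    (hb : ∀ s, 0 < s → |p s| ≤ C / s) (hb' : ∀ s, 0 < s → |p' s| ≤ C / s ^ 2)
    {ψ : (Fin 4 → ℝ) → Fin 4 → ℝ} (hψ : ∀ ν, ContDiff ℝ 2 fun x => ψ x ν)
    (hs : ∀ ν, HasCompactSupport fun x => ψ x ν) :
    HasZeroIntegral fun x => stressContraction (p (radiusSq x))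
      (p (radiusSq x) + radiusSq x * p' (radiusSq x)) (-p' (radiusSq x)) ψ x := by
  have hC : 0 ≤ C := by simpa using (abs_nonneg _).trans (hb 1 one_pos)
  let ε : ℕ → ℝ := fun n => 1 / ((n : ℝ) + 1)
  have hε : ∀ n, 0 < ε n := fun n => by positivity
  have hε0 : Filter.Tendsto ε Filter.atTop (nhds 0) := tendsto_one_div_add_atTop_nhds_zero_nat
  -- The factor of p' stays s, not s + ε: this is the stress tensor generated by the shifted profile
  -- F(s) = p(s + ε), so it is exactly divergence free.
  let u : ℕ → (Fin 4 → ℝ) → ℝ := fun n x => stressContraction (p (radiusSq x + ε n))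
      (p (radiusSq x + ε n) + radiusSq x * p' (radiusSq x + ε n)) (-p' (radiusSq x + ε n)) ψ x
  have hu : ∀ n, HasZeroIntegral (u n) := fun n =>
    hasZeroIntegral_stressContraction_of_regular (F := fun s => p (s + ε n))
      (F' := fun s => p' (s + ε n))
      (fun s hs => (hp (s + ε n) (add_pos_of_nonneg_of_pos hs (hε n))).comp_add_const s (ε n))
      (hp'.comp (by fun_prop) fun s hs => add_pos_of_nonneg_of_pos hs (hε n)) hψ hs
  let B : (Fin 4 → ℝ) → ℝ := fun x =>
    4 * C * ((radiusSq x)⁻¹ * ∑ μ, ∑ ν, |partialDeriv μ (fun y => ψ y ν) x|)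
  have hB : MeasureTheory.Integrable B := by
    refine MeasureTheory.Integrable.const_mul ?_ _
    simp only [Finset.mul_sum]
    refine MeasureTheory.integrable_finsetSum _ fun μ _ =>
      MeasureTheory.integrable_finsetSum _ fun ν _ => integrable_inv_radiusSq_mul ?_ ?_
    · exact (continuous_partialDeriv ((hψ ν).of_le one_le_two) μ).abs
    · exact ((hs ν).partialDeriv μ).comp_left abs_zero
  have huB : ∀ n, ∀ᵐ x, ‖u n x‖ ≤ B x := by
    intro n
    filter_upwards [ae_ne_zero] with x hx
    have h0 := radiusSq_pos_of_ne_zero hx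
    have h1 : 0 < radiusSq x + ε n := add_pos h0 (hε n)
    have h2 : radiusSq x ≤ radiusSq x + ε n := by linarith [hε n]
    have h3 := (hb _ h1).trans (div_le_div_of_nonneg_left hC h0 h2)
    have h4 : |p' (radiusSq x + ε n)| * radiusSq x ≤ C / radiusSq x := by
      refine (mul_le_mul_of_nonneg_right ((hb' _ h1).trans
        (div_le_div_of_nonneg_left hC (by positivity) (pow_le_pow_left₀ h0.le h2 2))) h0.le).trans
        (le_of_eq ?_)
      field_simp
    refine (abs_stressContraction_le (C := C / radiusSq x) h3 ?_ (by rwa [abs_neg]) ψ).trans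
      (le_of_eq ?_)
    · refine (abs_add_le _ _).trans ?_
      rw [abs_mul, abs_of_pos h0]
      linarith
    · simp only [B]; ring
  have hlim : ∀ᵐ x, Filter.Tendsto (fun n => u n x) Filter.atTop
      (nhds (stressContraction (p (radiusSq x))
        (p (radiusSq x) + radiusSq x * p' (radiusSq x)) (-p' (radiusSq x)) ψ x)) := by
    filter_upwards [ae_ne_zero] with x hx
    have h0 := radiusSq_pos_of_ne_zero hx
    have hadd : Filter.Tendsto (fun n => radiusSq x + ε n) Filter.atTop (nhds (radiusSq x)) := by
      simpa using hε0.const_add (radiusSq x)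
    have t1 := (hp _ h0).continuousAt.tendsto.comp hadd
    have t2 := (hp'.continuousAt (Ioi_mem_nhds h0)).tendsto.comp hadd
    simp only [Function.comp_def] at t1 t2
    exact tendsto_finsetSum _ fun μ _ => tendsto_finsetSum _ fun ν _ =>
      (((t1.mul_const _).add ((t1.add (t2.const_mul _)).mul_const _)).add
        (t2.neg.mul_const _)).mul_const _
  -- Measurability of the singular integrand is inherited from the regularized ones.
  have hmeas := aestronglyMeasurable_of_tendsto_ae Filter.atTop
    (fun n => (hu n).1.aestronglyMeasurable) hlim
  refine ⟨hB.mono' hmeas ?_, ?_⟩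
  · filter_upwards [hlim, MeasureTheory.ae_all_iff.2 huB] with x hx hxB
    exact le_of_tendsto hx.norm (Filter.Eventually.of_forall hxB)
  · have h := MeasureTheory.tendsto_integral_of_dominated_convergence B
      (fun n => (hu n).1.aestronglyMeasurable) hB huB hlim
    simp only [(hu _).2] at h
    exact tendsto_nhds_unique h tendsto_const_nhds

/-! ### The mass function -/

theorem hasDerivAt_integral_Ioi {f : ℝ → ℝ} {a r : ℝ} (har : a < r)
    (hf : ContinuousOn f (Set.Ioi a)) (hi : MeasureTheory.IntegrableOn f (Set.Ioi a)) :
    HasDerivAt (fun y => ∫ s in Set.Ioi y, f s) (-f r) r := by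
  have hii : ∀ y, a ≤ y → IntervalIntegrable f MeasureTheory.volume a y := fun y hy =>
    (intervalIntegrable_iff_integrableOn_Ioc_of_le hy).2 (hi.mono_set Set.Ioc_subset_Ioi_self)
  have hd : HasDerivAt (fun y => (∫ s in Set.Ioi a, f s) - ∫ s in a..y, f s) (-f r) r :=
    (intervalIntegral.integral_hasDerivAt_right (hii r har.le)
      (hf.stronglyMeasurableAtFilter isOpen_Ioi r har)
      (hf.continuousAt (Ioi_mem_nhds har))).const_sub _
  refine hd.congr_of_eventuallyEq ?_
  filter_upwards [Ioi_mem_nhds har] with y hy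
  rw [← intervalIntegral.integral_interval_add_Ioi hi
    (hi.mono_set (Set.Ioi_subset_Ioi (le_of_lt hy)))]
  ring

namespace AdmissibleHamiltonian

variable {ζ : ℝ → ℝ} {c Q M : ℝ}

theorem continuousOn (hζ : AdmissibleHamiltonian ζ) : ContinuousOn ζ (Set.Ioi 0) :=
  fun μ hμ => (hζ.diff μ hμ).continuousAt.continuousWithinAt

theorem continuousOn_deriv (hζ : AdmissibleHamiltonian ζ) : ContinuousOn (deriv ζ) (Set.Ioi 0) :=
  fun μ hμ => (hζ.diff_deriv μ hμ).continuousAt.continuousWithinAt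

theorem nonneg (hζ : AdmissibleHamiltonian ζ) {μ : ℝ} (hμ : 0 < μ) : 0 ≤ ζ μ := by
  have h := hζ.R2 μ hμ
  nlinarith [mul_pos hμ h.1]

theorem continuousOn_massDensity (hζ : AdmissibleHamiltonian ζ) (hQ : Q ≠ 0) :
    ContinuousOn (fun s => ζ (Q ^ 2 / (2 * s ^ 4)) * s ^ 2) (Set.Ioi 0) := by
  refine (hζ.continuousOn.comp (continuousOn_const.div (by fun_prop) fun s hs => ?_)
    fun s hs => ?_).mul (by fun_prop)
  · have : (0 : ℝ) < s := hs
    positivity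
  · have : (0 : ℝ) < s := hs
    have hμ : 0 < Q ^ 2 / (2 * s ^ 4) := by positivity
    exact hμ

/-- By `R1`, ζ(μ) < 2μ for small μ, so the density is at most Q²/s² for large s. -/
theorem integrableOn_massDensity (hζ : AdmissibleHamiltonian ζ) (hQ : Q ≠ 0) {a : ℝ}
    (ha : 0 < a) :
    MeasureTheory.IntegrableOn (fun s => ζ (Q ^ 2 / (2 * s ^ 4)) * s ^ 2) (Set.Ioi a) := by
  have hc : ContinuousOn (fun s => ζ (Q ^ 2 / (2 * s ^ 4)) * s ^ 2) (Set.Ici a) :=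
    (hζ.continuousOn_massDensity hQ).mono fun s hs => lt_of_lt_of_le ha hs
  have hlim : Filter.Tendsto (fun s : ℝ => Q ^ 2 / (2 * s ^ 4)) Filter.atTop
      (nhdsWithin 0 (Set.Ioi 0)) := by
    refine tendsto_nhdsWithin_iff.2 ⟨?_, ?_⟩
    · exact Filter.Tendsto.const_div_atTop
        ((Filter.tendsto_pow_atTop four_ne_zero).const_mul_atTop two_pos) _
    · filter_upwards [Filter.eventually_gt_atTop 0] with s hs
      exact Set.mem_Ioi.2 (by positivity)
  have hev := hlim.eventually (hζ.R1.eventually (gt_mem_nhds one_lt_two))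
  refine ((hc.locallyIntegrableOn measurableSet_Ici).integrableOn_of_isBigO_atTop
    (g := fun s : ℝ => s ^ (-2 : ℝ)) ?_ ?_).mono_set Set.Ioi_subset_Ici_self
  · refine Asymptotics.IsBigO.of_bound (Q ^ 2) ?_
    filter_upwards [hev, Filter.eventually_gt_atTop 0] with s hs hs0
    have hμ : 0 < Q ^ 2 / (2 * s ^ 4) := by positivity
    rw [div_lt_iff₀ hμ] at hs
    rw [Real.norm_of_nonneg (mul_nonneg (hζ.nonneg hμ) (sq_nonneg s)),
      Real.norm_of_nonneg (Real.rpow_nonneg hs0.le _), Real.rpow_neg hs0.le]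
    calc ζ (Q ^ 2 / (2 * s ^ 4)) * s ^ 2 ≤ 2 * (Q ^ 2 / (2 * s ^ 4)) * s ^ 2 := by gcongr
      _ = Q ^ 2 * (s ^ (2 : ℝ))⁻¹ := by
        rw [Real.rpow_two]; field_simp
  · exact ⟨Set.Ioi 1, Filter.Ioi_mem_atTop 1,
      integrableOn_Ioi_rpow_of_lt (by norm_num) one_pos⟩

theorem hasDerivAt_massFunction (hζ : AdmissibleHamiltonian ζ) (hQ : Q ≠ 0) {r : ℝ}
    (hr : 0 < r) :
    HasDerivAt (massFunction c Q M ζ) (1 / c ^ 2 * (ζ (Q ^ 2 / (2 * r ^ 4)) * r ^ 2)) r := by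
  have h := ((hasDerivAt_integral_Ioi (half_lt_self hr)
    ((hζ.continuousOn_massDensity hQ).mono (Set.Ioi_subset_Ioi (half_pos hr).le))
    (hζ.integrableOn_massDensity hQ (half_pos hr))).const_mul (1 / c ^ 2)).const_sub M
  exact h.congr_deriv (by ring)

end AdmissibleHamiltonian

/-! ### Electrostatic spacetimes -/

/-- The lapse `e^{2α}` as a function of the squared area radius. -/
def radialLapse (GN c Q M : ℝ) (ζ : ℝ → ℝ) (s : ℝ) : ℝ :=
  1 - 2 * GN * massFunction c Q M ζ (Real.sqrt s) / (c ^ 2 * Real.sqrt s)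

/-- The eigenvalue of the Einstein tensor on the plane of `∂_t` and `∂_r`, as a function of the
squared area radius. -/
def radialPressure (GN c Q : ℝ) (ζ : ℝ → ℝ) (s : ℝ) : ℝ :=
  -(2 * GN / c ^ 4) * ζ (Q ^ 2 / (2 * s ^ 2))

/-- The derivative of `radialPressure`. -/
def radialPressureDeriv (GN c Q : ℝ) (ζ : ℝ → ℝ) (s : ℝ) : ℝ :=
  2 * GN / c ^ 4 * (deriv ζ (Q ^ 2 / (2 * s ^ 2)) * (Q ^ 2 / s ^ 3))

section

variable {GN c Q M : ℝ} {ζ : ℝ → ℝ}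

theorem hasDerivAt_radialPressure (hζ : AdmissibleHamiltonian ζ) (hQ : Q ≠ 0) {s : ℝ}
    (hs : 0 < s) :
    HasDerivAt (radialPressure GN c Q ζ) (radialPressureDeriv GN c Q ζ s) s := by
  have h1 : HasDerivAt (fun s : ℝ => Q ^ 2 / (2 * s ^ 2)) (-(Q ^ 2 / s ^ 3)) s := by
    refine ((hasDerivAt_const s (Q ^ 2)).fun_div ((hasDerivAt_pow 2 s).const_mul 2)
      (by positivity)).congr_deriv ?_
    field_simp
    norm_num
    ring
  have hμ : 0 < Q ^ 2 / (2 * s ^ 2) := by positivity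
  refine (((hζ.diff _ hμ).hasDerivAt.comp s h1).const_mul (-(2 * GN / c ^ 4))).congr_deriv ?_
  rw [radialPressureDeriv]; ring

theorem continuousOn_radialPressureDeriv (hζ : AdmissibleHamiltonian ζ) (hQ : Q ≠ 0) :
    ContinuousOn (radialPressureDeriv GN c Q ζ) (Set.Ioi 0) := by
  refine continuousOn_const.mul ((hζ.continuousOn_deriv.comp (continuousOn_const.div
    (by fun_prop) fun s hs => ?_) fun s hs => ?_).mul
    (continuousOn_const.div (by fun_prop) fun s hs => ?_))
  all_goals have : (0 : ℝ) < s := hs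
  · positivity
  · have hμ : 0 < Q ^ 2 / (2 * s ^ 2) := by positivity
    exact hμ
  · positivity

/-- At μ = Q²/(2s²) the bound J√μ is a constant times 1/s. It controls ζ(μ), and also 2μζ'(μ), which
is s|p'| up to the constant 2G/c⁴. -/
theorem exists_radialPressure_bounds (hG : 0 < GN) (hc : 0 < c) (hζ : AdmissibleHamiltonian ζ)
    (hQ : Q ≠ 0) :
    ∃ C, (∀ s, 0 < s → |radialPressure GN c Q ζ s| ≤ C / s) ∧
      ∀ s, 0 < s → |radialPressureDeriv GN c Q ζ s| ≤ C / s ^ 2 := by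
  obtain ⟨J, K, L, hJ, hK, hL, h⟩ := hζ.R5
  have hsqrt : ∀ s : ℝ, 0 < s → Real.sqrt (Q ^ 2 / (2 * s ^ 2)) = Real.sqrt (Q ^ 2 / 2) / s := by
    intro s hs
    rw [← div_div, Real.sqrt_div' _ (sq_nonneg s), Real.sqrt_sq hs.le]
  refine ⟨2 * GN / c ^ 4 * (J * Real.sqrt (Q ^ 2 / 2)), fun s hs => ?_, fun s hs => ?_⟩
  all_goals
    have hμ : 0 < Q ^ 2 / (2 * s ^ 2) := by positivity
    obtain ⟨⟨-, h1⟩, -, h2⟩ := h _ hμ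
    rw [hsqrt s hs] at h1 h2
  · rw [radialPressure, abs_mul, abs_neg, abs_of_pos (by positivity), abs_of_nonneg (hζ.nonneg hμ),
      mul_div_assoc (2 * GN / c ^ 4), mul_div_assoc J]
    exact mul_le_mul_of_nonneg_left h1 (by positivity)
  · have h3 := (hζ.R2 _ hμ).1
    rw [radialPressureDeriv, abs_of_pos (by positivity),
      mul_div_assoc (2 * GN / c ^ 4)]
    refine mul_le_mul_of_nonneg_left ?_ (by positivity)
    calc deriv ζ (Q ^ 2 / (2 * s ^ 2)) * (Q ^ 2 / s ^ 3)
        = 2 * deriv ζ (Q ^ 2 / (2 * s ^ 2)) * (Q ^ 2 / (2 * s ^ 2)) / s := by field_simp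
      _ ≤ J * (Real.sqrt (Q ^ 2 / 2) / s) / s := by gcongr
      _ = _ := by field_simp

/-- This is the field equation 2sφ' + φ - 1 = s p, equivalent to m'(r) = ζ r²/c². The mass itself is
absorbed in φ. -/
theorem hasDerivAt_radialLapse (hc : 0 < c) (hζ : AdmissibleHamiltonian ζ) (hQ : Q ≠ 0) {s : ℝ}
    (hs : 0 < s) :
    HasDerivAt (radialLapse GN c Q M ζ)
      ((radialPressure GN c Q ζ s - (radialLapse GN c Q M ζ s - 1) / s) / 2) s := by
  have hr : 0 < Real.sqrt s := Real.sqrt_pos.2 hs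
  have hd := Real.hasDerivAt_sqrt hs.ne'
  have hm := (hζ.hasDerivAt_massFunction (c := c) (M := M) hQ hr).comp s hd
  refine (((hm.const_mul (2 * GN)).fun_div (hd.const_mul (c ^ 2))
    (by positivity)).const_sub 1).congr_deriv ?_
  have hr4 : Real.sqrt s ^ 4 = s ^ 2 := by
    rw [show (4 : ℕ) = 2 * 2 from rfl, pow_mul, Real.sq_sqrt hs.le]
  simp only [radialPressure, radialLapse, Function.comp_apply, hr4]
  have hss : s = Real.sqrt s ^ 2 := (Real.sq_sqrt hs.le).symm
  generalize ζ (Q ^ 2 / (2 * s ^ 2)) = z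
  generalize Real.sqrt s = r at *
  subst hss
  field_simp
  ring

/-- The second derivative comes from differentiating the first-order equation for φ, so ζ is
differentiated only once. -/
theorem isRadialProfile_radialLapse (hc : 0 < c) (hζ : AdmissibleHamiltonian ζ) (hQ : Q ≠ 0)
    (hpos : ∀ s, 0 < s → 0 < radialLapse GN c Q M ζ s) :
    IsRadialProfile (radialLapse GN c Q M ζ)
      (fun s => (radialPressure GN c Q ζ s - (radialLapse GN c Q M ζ s - 1) / s) / 2)
      (fun s => (radialPressureDeriv GN c Q ζ s -
        ((radialPressure GN c Q ζ s - (radialLapse GN c Q M ζ s - 1) / s) / 2 * s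
          - (radialLapse GN c Q M ζ s - 1)) / s ^ 2) / 2) where
  pos := hpos
  hasDerivAt _ hs := hasDerivAt_radialLapse hc hζ hQ hs
  hasDerivAt_deriv s hs := by
    refine (((hasDerivAt_radialPressure hζ hQ hs).fun_sub
      (((hasDerivAt_radialLapse hc hζ hQ hs).sub_const 1).fun_div (hasDerivAt_id' s)
        hs.ne')).div_const 2).congr_deriv ?_
    rw [mul_one]

theorem areaRadius_eq_sqrt (x : Fin 4 → ℝ) : areaRadius x = Real.sqrt (radiusSq x) := rfl

theorem staticSphericalMetric_eq_radialMetric {α φ : ℝ → ℝ} {x : Fin 4 → ℝ}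
    (hx : 0 < radiusSq x) (hα : Real.exp (2 * α (areaRadius x)) = φ (radiusSq x)) :
    staticSphericalMetric c α (fun r => -α r) x = radialMetric c φ x := by
  have hdr : ∀ μ ν, drForm x μ * drForm x ν
      = spatialPart x μ * spatialPart x ν / radiusSq x := by
    intro μ ν
    rw [← Real.sq_sqrt hx.le, ← areaRadius_eq_sqrt]
    simp only [drForm, spatialPart]
    split_ifs <;> simp [div_mul_div_comm, sq]
  ext μ ν
  simp only [staticSphericalMetric, radialMetric, Matrix.of_apply, hdr]
  rw [mul_neg, Real.exp_neg, hα]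
  ring

end

end

/-! ### Conclusion for the point-charge spacetime -/

theorem theorem4p2 (GN c Q M : ℝ) (hG : 0 < GN) (hc : 0 < c) (hQ : Q ≠ 0)
    (ζ : ℝ → ℝ) (hζ : AdmissibleHamiltonian ζ)
    (g F : TensorField2) (hgF : IsElectrostaticSpacetime GN c Q M ζ g F) :
    WeakBianchi g := by
  intro ψ hψ hψs
  obtain ⟨α, hα, hg⟩ := hgF.metric
  have hφ := isRadialProfile_radialLapse (GN := GN) (M := M) hc hζ hQ fun s hs => by
    rw [radialLapse, ← hα _ (Real.sqrt_pos.2 hs)]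
    exact Real.exp_pos _
  have hgr : ∀ y, 0 < radiusSq y → g y = radialMetric c (radialLapse GN c Q M ζ) y := by
    intro y hy
    have hr : 0 < areaRadius y := Real.sqrt_pos.2 hy
    rw [hg y hr]
    exact staticSphericalMetric_eq_radialMetric hy (hα _ hr)
  obtain ⟨C, hb, hb'⟩ := exists_radialPressure_bounds hG hc hζ hQ
  have h := (hasZeroIntegral_stressContraction (fun s hs => hasDerivAt_radialPressure hζ hQ hs)
    (continuousOn_radialPressureDeriv hζ hQ) hb hb'
    (fun ν => contDiff_infty.1 (contDiff_pi.1 hψ ν) 2)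
    (fun ν => hψs.comp_left (g := fun v : Fin 4 → ℝ => v ν) rfl)).const_mul |c|
  have hae : bianchiIntegrand g ψ =ᵐ[MeasureTheory.volume] fun x => |c| *
      stressContraction (radialPressure GN c Q ζ (radiusSq x)) (radialPressure GN c Q ζ (radiusSq x)
        + radiusSq x * radialPressureDeriv GN c Q ζ (radiusSq x))
        (-radialPressureDeriv GN c Q ζ (radiusSq x)) ψ x := by
    filter_upwards [ae_ne_zero] with x hx
    have hs := radiusSq_pos_of_ne_zero hx
    rw [bianchiIntegrand_radialMetric hc.ne' hφ hgr hs rfl rfl, mul_comm]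
    -- The goals are 2φ' + (φ - 1)/s = p, 3φ' + 2sφ'' = p + s p', and that the coefficient of X⊗X is
    -- -p'.
    congr 2
    · ring
    · field_simp; ring
    · field_simp; ring
  exact ⟨h.1.congr hae.symm, (MeasureTheory.integral_congr_ae hae).trans h.2⟩
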